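/- Let $K$ be a field and $S=K[x_1,\ldots,x_N]$, with its usual $\mathbb Z^N$-grading. A Stanley decomposition of a $\mathbb Z^N$-graded $S$-module $M\neq 0$ is a finite direct sum decomposition $\mathcal D:\ M=\bigoplus_{i=1}^r m_iK[Z_i]$ of $\mathbb Z^N$-graded $K$-vector spaces, where each $m_i\in M$ is homogeneous, $Z_i\subseteq\{x_1,\ldots,x_N\}$, and $m_iK[Z_i]=\{um_i : u\in K[Z_i]\}$ is a free $K[Z_i]$-module with basis $m_i$. Put $\operatorname{sdepth}(\mathcal D)=\min_i|Z_i|$, and let the Stanley depth $\operatorname{sdepth}(M)$ be the maximum of $\operatorname{sdepth}(\mathcal D)$ over all Stanley decompositions $\mathcal D$ of $M$. Proposition 2.2. Let $n\ge m\ge 1$ be integers, let $K$ be a field, and let $I=(x_1,\ldots,x_n)\cap(x_{n+1},\ldots,x_{n+m})\subset S=K[x_1,\ldots,x_{n+m}]$, where $I$ and $S/I$ carry the $\mathbb Z^{n+m}$-gradings induced by that of $S$. Then: (1) $m\ge\operatorname{sdepth}(S/I)\ge\min\{m,\lceil n/2\rceil\}$. (2) $m+\lceil n/2\rceil\ge\operatorname{sdepth}(I)\ge\lceil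 n/2\rceil+\lceil m/2\rceil$. (3) If $n\ge 2m-1$, then $\operatorname{sdepth}(S/I)=m$. -/

import Mathlib

open MvPolynomial

noncomputable section

namespace StanleyDepth

/-- For an element `m` of a module `M` over `S = K[x_i : i ∈ σ]` and a set `Z` of variables, the
`K`-subspace `m K[Z] = {u m : u ∈ K[Z]}` of `M`. -/
def stanleySpace {σ K M : Type*} [Field K] [AddCommGroup M] [Module K M]
    [Module (MvPolynomial σ K) M] [IsScalarTower K (MvPolynomial σ K) M]
    (m : M) (Z : Finset σ) : Submodule K M :=
  (Subalgebra.toSubmodule (supported K (Z : Set σ))).map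
    ((LinearMap.toSpanSingleton (MvPolynomial σ K) M m).restrictScalars K)

/-- A Stanley decomposition of a `ℤ^σ`-graded `S`-module `M`, where `S = K[x_i : i ∈ σ]` and
`ℳ a` is the component of `M` of degree `a`: finitely many homogeneous elements `m_i` and sets of
variables `Z_i` such that each `m_i K[Z_i]` is a free `K[Z_i]`-module (with basis `m_i`) and `M` is
the internal direct sum of the subspaces `m_i K[Z_i]`. (These are graded subspaces, as the `m_i`
are homogeneous, so that this is a direct sum of graded vector spaces.) -/
structure StanleyDecomposition {σ K M : Type*} [Field K] [AddCommGroup M] [Module K M]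
    [Module (MvPolynomial σ K) M] [IsScalarTower K (MvPolynomial σ K) M]
    (ℳ : (σ → ℤ) → Submodule K M) where
  /-- the number of summands -/
  r : ℕ
  /-- the generators of the summands -/
  m : Fin r → M
  /-- the sets of variables of the summands -/
  Z : Fin r → Finset σ
  homogeneous : ∀ i, ∃ a : σ → ℤ, m i ∈ ℳ a
  free : ∀ i, ∀ u ∈ supported K (Z i : Set σ), u • m i = 0 → u = 0
  isInternal : DirectSum.IsInternal fun i => stanleySpace (K := K) (m i) (Z i)

/-- The Stanley depth of a decomposition: the minimum of the `|Z_i|`. (If `M ≠ 0` there is at least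
one summand, and this is a genuine minimum.) -/
def StanleyDecomposition.depth {σ K M : Type*} [Field K] [AddCommGroup M] [Module K M]
    [Module (MvPolynomial σ K) M] [IsScalarTower K (MvPolynomial σ K) M]
    {ℳ : (σ → ℤ) → Submodule K M} (D : StanleyDecomposition ℳ) : ℕ :=
  ⨅ i, (D.Z i).card

/-- The Stanley depth of a graded module: the maximum of the depths of its Stanley decompositions.
(The depths are bounded by the number of variables, so that the supremum in `ℕ` is a maximum as soon
as there is a Stanley decomposition.) -/
def sdepth {σ K M : Type*} [Fintype σ] [Field K] [AddCommGroup M] [Module K M]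
    [Module (MvPolynomial σ K) M] [IsScalarTower K (MvPolynomial σ K) M]
    (ℳ : (σ → ℤ) → Submodule K M) : ℕ :=
  sSup (Set.range fun D : StanleyDecomposition ℳ => D.depth)

/-- The component of degree `a ∈ ℤ^σ` of the polynomial ring: the span of the monomial with exponent
vector `a` if `a ≥ 0`, and zero otherwise. -/
def polyGrading (σ K : Type*) [Field K] (a : σ → ℤ) : Submodule K (MvPolynomial σ K) :=
  restrictSupport K {u : σ →₀ ℕ | ∀ i, (u i : ℤ) = a i}

/-- The grading of an ideal `I`, as an `S`-module, induced by that of `S`. -/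
def idealGrading {σ K : Type*} [Field K] (I : Ideal (MvPolynomial σ K)) (a : σ → ℤ) :
    Submodule K I :=
  (polyGrading σ K a).comap ((Submodule.subtype I).restrictScalars K)

/-- The grading of a quotient `S/I` induced by that of `S`. -/
def quotientGrading {σ K : Type*} [Field K] (I : Ideal (MvPolynomial σ K)) (a : σ → ℤ) :
    Submodule K (MvPolynomial σ K ⧸ I) :=
  (polyGrading σ K a).map ((Submodule.mkQ I).restrictScalars K)

/-- The ideal `(x_1, …, x_n) ∩ (x_{n+1}, …, x_{n+m})` of `K[x_1, …, x_{n+m}]`. -/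
def bipartiteIdeal (K : Type*) [Field K] (n m : ℕ) : Ideal (MvPolynomial (Fin (n + m)) K) :=
  Ideal.span (Set.range fun i : Fin n => X (Fin.castAdd m i)) ⊓
    Ideal.span (Set.range fun j : Fin m => X (Fin.natAdd n j))

end StanleyDepth

end

/-!
The homogeneous components of `I` and of `S/I` are at most one-dimensional, so a Stanley
decomposition of one of them is the same as a partition of the set of exponents of its nonzero
monomials into cones `u + ℕ^Z`. The exponents in question are those whose support meets both blocks
of variables, respectively does not, so that a partition of such a family of supports into intervals
`[A, B]` gives one of the exponents into cones with `|Z| = |B|`.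

For the lower bounds, the nonempty subsets of a set with `n` elements are partitioned into intervals
with upper ends of size at least `⌈n/2⌉`: for odd `n` the intervals are indexed by the tilings of a
cycle of length `n` by tiles of lengths 1 and 2. For the upper bounds, let `y` be a variable of the
second block. The cone in `S/I` that contains `y` has no direction `x_i` from the first block. In
`I`, each `x_i y` is minimal, hence the apex of a cone. As `x_i x_j y` lies in only one cone, it
cannot be that `x_j` is a direction of the cone at `x_i y` and `x_i` one of the cone at `x_j y`, so
that some cone at `x_i y` has fewer than `n/2` directions `x_j` with `j ≠ i`.
-/

namespace StanleyDepth

open scoped Finset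

section IndexedPartition

/-- The sets `F i` partition the set `E`; empty parts are allowed. -/
structure IsIndexedPartition {ι α : Type*} (F : ι → Set α) (E : Set α) : Prop where
  subset : ∀ i, F i ⊆ E
  existsUnique : ∀ x ∈ E, ∃! i, x ∈ F i

variable {ι κ α β : Type*} {F : ι → Set α} {E : Set α}

namespace IsIndexedPartition

theorem preimage (h : IsIndexedPartition F E) (f : β → α) :
    IsIndexedPartition (fun i => f ⁻¹' F i) (f ⁻¹' E) :=
  ⟨fun i => Set.preimage_mono (h.subset i), fun x hx => h.existsUnique (f x) hx⟩

theorem image (h : IsIndexedPartition F E) {f : α → β} (hf : Function.Injective f) :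
    IsIndexedPartition (fun i => f '' F i) (f '' E) := by
  refine ⟨fun i => Set.image_mono (h.subset i), ?_⟩
  rintro _ ⟨x, hx, rfl⟩
  simpa only [hf.mem_set_image] using h.existsUnique x hx

theorem comp_equiv (h : IsIndexedPartition F E) (e : κ ≃ ι) : IsIndexedPartition (F ∘ e) E :=
  ⟨fun k => h.subset (e k), fun x hx =>
    (e.bijective.existsUnique_iff (p := fun i => x ∈ F i)).1 (h.existsUnique x hx)⟩

theorem sumElim (h : IsIndexedPartition F E) {G : κ → Set α} {E' : Set α}
    (h' : IsIndexedPartition G E') (hd : Disjoint E E') :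
    IsIndexedPartition (Sum.elim F G) (E ∪ E') := by
  refine ⟨?_, ?_⟩
  · rintro (i | k)
    exacts [(h.subset i).trans Set.subset_union_left, (h'.subset k).trans Set.subset_union_right]
  · rintro x (hx | hx)
    · obtain ⟨i, hi, hu⟩ := h.existsUnique x hx
      refine ⟨.inl i, hi, ?_⟩
      rintro (j | k) hj
      exacts [congrArg _ (hu j hj), (hd.notMem_of_mem_left hx (h'.subset k hj)).elim]
    · obtain ⟨k, hk, hu⟩ := h'.existsUnique x hx
      refine ⟨.inr k, hk, ?_⟩
      rintro (j | l) hj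
      exacts [(hd.notMem_of_mem_right hx (h.subset j hj)).elim, congrArg _ (hu l hj)]

theorem prod (h : IsIndexedPartition F E) {G : κ → Set β} {E' : Set β}
    (h' : IsIndexedPartition G E') :
    IsIndexedPartition (fun p : ι × κ => F p.1 ×ˢ G p.2) (E ×ˢ E') := by
  refine ⟨fun p => Set.prod_mono (h.subset p.1) (h'.subset p.2), ?_⟩
  rintro ⟨x, y⟩ ⟨hx, hy⟩
  obtain ⟨i, hi, hui⟩ := h.existsUnique x hx
  obtain ⟨k, hk, huk⟩ := h'.existsUnique y hy
  exact ⟨(i, k), ⟨hi, hk⟩, fun p hp => Prod.ext (hui p.1 hp.1) (huk p.2 hp.2)⟩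

end IsIndexedPartition

theorem isIndexedPartition_preimage_val_iff (hF : ∀ i, F i ⊆ E) :
    IsIndexedPartition (fun i => ((↑) : E → α) ⁻¹' F i) Set.univ ↔ IsIndexedPartition F E := by
  refine ⟨fun h => ?_, fun h => ?_⟩
  · simpa [Set.inter_eq_right.2 (hF _)] using h.image Subtype.val_injective
  · simpa using h.preimage ((↑) : E → α)

theorem isInternal_span_image_iff {K M : Type*} [Field K] [AddCommGroup M] [Module K M]
    [DecidableEq ι] (b : Module.Basis α K M) :
    (DirectSum.IsInternal fun i => Submodule.span K (b '' F i)) ↔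
      IsIndexedPartition F Set.univ := by
  have mem_span (s : Set α) (v : α) : b v ∈ Submodule.span K (b '' s) ↔ v ∈ s := by
    simp [b.mem_span_image]
  rw [DirectSum.isInternal_submodule_iff_iSupIndep_and_iSup_eq_top]
  simp_rw [iSupIndep_def, ← Submodule.span_iUnion, ← Set.image_iUnion]
  constructor
  · rintro ⟨hdisj, htop⟩
    refine ⟨fun i => Set.subset_univ _, fun v _ => ?_⟩
    obtain ⟨i, hi⟩ : ∃ i, v ∈ F i := Set.mem_iUnion.1 ((mem_span _ v).1 (htop ▸ Submodule.mem_top))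
    refine ⟨i, hi, fun j hj => ?_⟩
    by_contra hne
    exact b.ne_zero v (Submodule.disjoint_def.1 (hdisj i) _ ((mem_span _ v).2 hi)
      ((mem_span _ v).2 (Set.mem_iUnion₂.2 ⟨j, hne, hj⟩)))
  · intro h
    refine ⟨fun i => b.linearIndependent.disjoint_span_image (Set.disjoint_left.2 ?_), ?_⟩
    · simp only [Set.mem_iUnion, not_exists]
      exact fun v hi j hne hj => hne ((h.existsUnique v trivial).unique hj hi)
    · rw [Set.iUnion_eq_univ_iff.2 fun v => (h.existsUnique v trivial).exists, Set.image_univ,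
        b.span_eq]

end IndexedPartition

section IntervalPartition

variable {σ τ : Type*}

/-- The family `𝓔` of finite sets is partitioned into finitely many nonempty intervals `[A i, B i]`
whose upper ends have at least `k` elements. -/
def HasIntervalPartition (𝓔 : Set (Finset σ)) (k : ℕ) : Prop :=
  ∃ (ι : Type) (_ : Finite ι) (A B : ι → Finset σ),
    IsIndexedPartition (fun i => Set.Icc (A i) (B i)) 𝓔 ∧ ∀ i, A i ⊆ B i ∧ k ≤ #(B i)

theorem mem_Icc_union_iff [DecidableEq σ] {A B A' B' C S : Finset σ} (hA : A ⊆ S) (hB : B ⊆ S)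
    (hA' : Disjoint A' S) (hB' : Disjoint B' S) :
    C ∈ Set.Icc (A ∪ A') (B ∪ B') ↔ C ∩ S ∈ Set.Icc A B ∧ C \ S ∈ Set.Icc A' B' := by
  simp only [Set.mem_Icc, Finset.subset_iff, Finset.disjoint_left] at *
  grind

namespace HasIntervalPartition

variable {𝓔 𝓕 : Set (Finset σ)} {k l : ℕ}

theorem empty (k : ℕ) : HasIntervalPartition (∅ : Set (Finset σ)) k :=
  ⟨Empty, inferInstance, nofun, nofun, ⟨nofun, nofun⟩, nofun⟩

theorem of_Icc {A B : Finset σ} (h : A ⊆ B) : HasIntervalPartition (Set.Icc A B) #B :=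
  ⟨Unit, inferInstance, fun _ => A, fun _ => B,
    ⟨fun _ => subset_rfl, fun _ hC => ⟨(), hC, fun _ _ => rfl⟩⟩, fun _ => ⟨h, le_rfl⟩⟩

theorem mono (h : HasIntervalPartition 𝓔 k) (hl : l ≤ k) : HasIntervalPartition 𝓔 l := by
  obtain ⟨ι, hι, A, B, hP, hAB⟩ := h
  exact ⟨ι, hι, A, B, hP, fun i => ⟨(hAB i).1, hl.trans (hAB i).2⟩⟩

theorem union (h : HasIntervalPartition 𝓔 k) (h' : HasIntervalPartition 𝓕 k)
    (hd : Disjoint 𝓔 𝓕) : HasIntervalPartition (𝓔 ∪ 𝓕) k := by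
  obtain ⟨ι, _, A, B, hP, hAB⟩ := h
  obtain ⟨κ, _, A', B', hP', hAB'⟩ := h'
  refine ⟨ι ⊕ κ, inferInstance, Sum.elim A A', Sum.elim B B', ?_, Sum.rec hAB hAB'⟩
  convert hP.sumElim hP' hd using 1
  ext (i | i) : 1 <;> rfl

theorem image_map (h : HasIntervalPartition 𝓔 k) (f : σ ↪ τ) :
    HasIntervalPartition (Finset.map f '' 𝓔) k := by
  obtain ⟨ι, hι, A, B, hP, hAB⟩ := h
  refine ⟨ι, hι, fun i => (A i).map f, fun i => (B i).map f, ?_,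
    fun i => ⟨Finset.map_subset_map.2 (hAB i).1, by simpa using (hAB i).2⟩⟩
  convert hP.image (Finset.map_injective f) with i
  ext C
  constructor
  · rintro ⟨hA, hB⟩
    obtain ⟨D, hD, rfl⟩ := Finset.subset_map_iff.1 hB
    exact ⟨D, ⟨Finset.map_subset_map.1 hA, hD⟩, rfl⟩
  · rintro ⟨D, ⟨hA, hB⟩, rfl⟩
    exact ⟨Finset.map_subset_map.2 hA, Finset.map_subset_map.2 hB⟩

theorem inter_sdiff [DecidableEq σ] {S : Finset σ} (h : HasIntervalPartition 𝓔 k)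
    (h' : HasIntervalPartition 𝓕 l) (h𝓔 : ∀ C ∈ 𝓔, C ⊆ S) (h𝓕 : ∀ C ∈ 𝓕, Disjoint C S) :
    HasIntervalPartition {C | C ∩ S ∈ 𝓔 ∧ C \ S ∈ 𝓕} (k + l) := by
  obtain ⟨ι, _, A, B, hP, hAB⟩ := h
  obtain ⟨κ, _, A', B', hP', hAB'⟩ := h'
  have hB i : B i ⊆ S := h𝓔 _ (hP.subset i ⟨(hAB i).1, le_rfl⟩)
  have hB' j : Disjoint (B' j) S := h𝓕 _ (hP'.subset j ⟨(hAB' j).1, le_rfl⟩)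
  refine ⟨ι × κ, inferInstance, fun p => A p.1 ∪ A' p.2, fun p => B p.1 ∪ B' p.2, ?_,
    fun p => ⟨Finset.union_subset_union (hAB p.1).1 (hAB' p.2).1, ?_⟩⟩
  · convert (hP.prod hP').preimage fun C : Finset σ => (C ∩ S, C \ S) with p
    · ext C
      exact mem_Icc_union_iff ((hAB p.1).1.trans (hB p.1)) (hB p.1)
        ((hB' p.2).mono_left (hAB' p.2).1) (hB' p.2)
    · rfl
  · rw [Finset.card_union_of_disjoint ((hB' p.2).symm.mono_left (hB p.1))]
    exact add_le_add (hAB p.1).2 (hAB' p.2).2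

end HasIntervalPartition

end IntervalPartition

section CycleTiling

theorem existsUnique_cyclic_recurrence {α : Type*} {n : ℕ} [NeZero n] (f : ZMod n → α → α)
    {c : ZMod n} {a : α} (hc : ∀ x, f c x = a) : ∃! t : ZMod n → α, ∀ i, t (i + 1) = f i (t i) := by
  obtain ⟨s, s_zero, s_succ⟩ : ∃ s : ℕ → α, s 0 = a ∧ ∀ j : ℕ, s (j + 1) = f (c + 1 + j) (s j) :=
    ⟨fun j => Nat.rec a (fun j x => f (c + 1 + j) x) j, rfl, fun _ => rfl⟩
  have s_periodic : Function.Periodic s n := by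
    intro j
    induction j with
    | zero =>
      obtain ⟨k, hk⟩ := Nat.exists_eq_succ_of_ne_zero (NeZero.ne n)
      have hk0 : (1 + k : ZMod n) = 0 := by
        rw [add_comm]; exact_mod_cast (congrArg (Nat.cast : ℕ → ZMod n) hk).symm.trans
          (ZMod.natCast_self n)
      rw [zero_add, hk, Nat.succ_eq_add_one, s_succ, add_assoc, hk0, add_zero, hc, s_zero]
    | succ j ih =>
      rw [add_right_comm, s_succ, s_succ, ih, Nat.cast_add, ZMod.natCast_self, add_zero]
  refine ⟨fun i => s (i - (c + 1)).val, fun i => ?_, fun t ht => ?_⟩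
  · have hval : (i + 1 - (c + 1)).val = ((i - (c + 1)).val + 1) % n := by
      rw [← ZMod.val_natCast, Nat.cast_add, Nat.cast_one, ZMod.natCast_zmod_val,
        add_sub_right_comm]
    simp only [hval, s_periodic.map_mod_nat, s_succ, ZMod.natCast_zmod_val, add_sub_cancel]
  · have t_eq_s (j : ℕ) : t (c + 1 + j) = s j := by
      induction j with
      | zero => rw [Nat.cast_zero, add_zero, ht, hc, s_zero]
      | succ j ih => rw [Nat.cast_succ, ← add_assoc, ht, ih, s_succ]
    funext i
    rw [← t_eq_s, ZMod.natCast_zmod_val, add_sub_cancel]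

variable {n : ℕ}

/-- If `T` consists of the first elements of the tiles in a tiling of the cycle `ZMod n` by
intervals, then these are the last elements of the tiles. -/
def tileEnds (T : Finset (ZMod n)) : Finset (ZMod n) :=
  T.map (Equiv.subRight 1).toEmbedding

theorem mem_tileEnds {T : Finset (ZMod n)} {i : ZMod n} : i ∈ tileEnds T ↔ i + 1 ∈ T := by
  simp [tileEnds, Finset.mem_map_equiv]

theorem card_tileEnds (T : Finset (ZMod n)) : #(tileEnds T) = #T :=
  Finset.card_map _

variable [NeZero n]

/-- The sets of first elements of the tiles in the tilings of the cycle `ZMod n` by tiles of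
lengths 1 and 2: an element that does not start a tile is the last element of a tile. -/
def cycleTilings (n : ℕ) [NeZero n] : Set (Finset (ZMod n)) :=
  {T | Tᶜ ⊆ tileEnds T}

theorem le_two_mul_card_of_mem_cycleTilings {T : Finset (ZMod n)} (hT : T ∈ cycleTilings n) :
    n ≤ 2 * #T := by
  have h := Finset.card_le_card hT
  rw [Finset.card_compl, ZMod.card, card_tileEnds] at h
  omega

theorem inter_tileEnds_nonempty (hn : Odd n) {T : Finset (ZMod n)} (hT : T ∈ cycleTilings n) :
    (T ∩ tileEnds T).Nonempty := by
  rw [← Finset.not_disjoint_iff_nonempty_inter]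
  intro hdisj
  have hle := (Finset.card_union_of_disjoint hdisj).symm.trans_le (Finset.card_le_univ _)
  rw [card_tileEnds, ZMod.card] at hle
  have := le_two_mul_card_of_mem_cycleTilings hT
  obtain ⟨k, rfl⟩ := hn
  omega

theorem mem_cycleTilings_and_mem_Icc_iff {T C : Finset (ZMod n)} :
    T ∈ cycleTilings n ∧ C ∈ Set.Icc (T ∩ tileEnds T) (tileEnds T) ↔
      ∀ i, i + 1 ∈ T ↔ i ∉ T ∨ i ∈ C := by
  simp only [cycleTilings, Set.mem_ofPred_eq, Set.mem_Icc, Finset.subset_iff,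
    Finset.mem_inter, Finset.mem_compl, mem_tileEnds, ← forall_and]
  exact forall_congr' fun i => by tauto

theorem existsUnique_cycleTiling {C : Finset (ZMod n)} (hC : C.Nonempty) :
    ∃! T : Finset (ZMod n), ∀ i, i + 1 ∈ T ↔ i ∉ T ∨ i ∈ C := by
  classical
  obtain ⟨c, hc⟩ := hC
  obtain ⟨t, ht, ht_unique⟩ := existsUnique_cyclic_recurrence (fun i p => ¬ p ∨ i ∈ C)
    (c := c) (a := True) fun p => by simp [hc]
  refine ⟨Finset.univ.filter t, fun i => by simp [ht], fun T hT => ?_⟩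
  have := ht_unique (· ∈ T) fun i => propext (hT i)
  ext i
  simp [← this]

/-- The intervals correspond to the tilings of the cycle by tiles of lengths 1 and 2: the lower end
consists of the tiles of length 1, the upper end of the last elements of all tiles. -/
theorem hasIntervalPartition_nonempty_zmod (hn : Odd n) :
    HasIntervalPartition {C : Finset (ZMod n) | C.Nonempty} ((n + 1) / 2) := by
  refine ⟨cycleTilings n, inferInstance, fun T => T ∩ tileEnds T, fun T => tileEnds T,
    ⟨fun T C hC => (inter_tileEnds_nonempty hn T.2).mono hC.1, fun C hC => ?_⟩,
    fun T => ⟨Finset.inter_subset_right, ?_⟩⟩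
  · obtain ⟨T, hT, hT_unique⟩ := existsUnique_cycleTiling hC
    obtain ⟨hTt, hTC⟩ := mem_cycleTilings_and_mem_Icc_iff.2 hT
    exact ⟨⟨T, hTt⟩, hTC, fun T' hT' =>
      Subtype.ext (hT_unique _ (mem_cycleTilings_and_mem_Icc_iff.1 ⟨T'.2, hT'⟩))⟩
  · have := le_two_mul_card_of_mem_cycleTilings T.2
    rw [card_tileEnds]
    omega

end CycleTiling

section NonemptySubsets

variable {σ : Type*}

theorem image_map_nonempty {τ : Type*} [Fintype τ] (f : τ ↪ σ) :
    Finset.map f '' {C | C.Nonempty} = {C | C.Nonempty ∧ C ⊆ Finset.univ.map f} := by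
  ext C
  constructor
  · rintro ⟨D, hD, rfl⟩
    exact ⟨hD.map, Finset.map_subset_map.2 (Finset.subset_univ D)⟩
  · rintro ⟨hC, hCf⟩
    obtain ⟨D, -, rfl⟩ := Finset.subset_map_iff.1 hCf
    exact ⟨D, Finset.map_nonempty.1 hC, rfl⟩

theorem hasIntervalPartition_nonempty_subsets_of_odd {A : Finset σ} (hA : Odd #A) :
    HasIntervalPartition {C | C.Nonempty ∧ C ⊆ A} ((#A + 1) / 2) := by
  have : NeZero #A := ⟨hA.pos.ne'⟩
  let e : ZMod #A ≃ A := Fintype.equivOfCardEq (by simp [ZMod.card])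
  have h := (hasIntervalPartition_nonempty_zmod hA).image_map
    (e.toEmbedding.trans (Function.Embedding.subtype (· ∈ A)))
  rwa [image_map_nonempty, ← Finset.map_map, Finset.map_univ_equiv, Finset.univ_eq_attach,
    Finset.attach_map_val] at h

theorem setOf_nonempty_subset_insert [DecidableEq σ] {a : σ} {A : Finset σ} (ha : a ∉ A) :
    {C | C.Nonempty ∧ C ⊆ insert a A} =
      {C | C.Nonempty ∧ C ⊆ A} ∪ Set.Icc {a} (insert a A) := by
  ext C
  by_cases haC : a ∈ C
  · have hC : C.Nonempty := ⟨a, haC⟩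
    have hCA : ¬ C ⊆ A := fun h => ha (h haC)
    simp [haC, hC, hCA]
  · simp [haC, Finset.subset_insert_iff_of_notMem]

theorem hasIntervalPartition_nonempty_subsets (A : Finset σ) :
    HasIntervalPartition {C | C.Nonempty ∧ C ⊆ A} ((#A + 1) / 2) := by
  classical
  rcases Nat.even_or_odd #A with hA | hA
  · rcases A.eq_empty_or_nonempty with rfl | ⟨a, ha⟩
    · convert HasIntervalPartition.empty (σ := σ) _
      exact Set.eq_empty_iff_forall_notMem.2 fun C ⟨hC, hC'⟩ =>
        hC.ne_empty (Finset.subset_empty.1 hC')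
    · obtain ⟨B, haB, rfl⟩ : ∃ B, a ∉ B ∧ insert a B = A :=
        ⟨A.erase a, A.notMem_erase a, Finset.insert_erase ha⟩
      rw [Finset.card_insert_of_notMem haB] at hA ⊢
      have hB : Odd #B := Nat.not_even_iff_odd.1 (Nat.even_add_one.1 hA)
      rw [setOf_nonempty_subset_insert haB]
      refine ((hasIntervalPartition_nonempty_subsets_of_odd hB).mono ?_).union
        ((HasIntervalPartition.of_Icc (by simp)).mono ?_) ?_
      · obtain ⟨k, hk⟩ := hB
        omega
      · rw [Finset.card_insert_of_notMem haB]
        omega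
      · exact Set.disjoint_left.2 fun C hC hC' => haB (hC.2 (hC'.1 (by simp)))
  · exact hasIntervalPartition_nonempty_subsets_of_odd hA

end NonemptySubsets

section Cone

variable {σ : Type*} {u v : σ →₀ ℕ} {Z : Finset σ} {E : Set (σ →₀ ℕ)} {k : ℕ}

/-- The set of exponents of the monomials in `x^u K[Z]`. -/
def cone (u : σ →₀ ℕ) (Z : Finset σ) : Set (σ →₀ ℕ) :=
  {v | u ≤ v ∧ ∀ i ∉ Z, v i = u i}

theorem mem_cone_iff_exists_add : v ∈ cone u Z ↔ ∃ w : σ →₀ ℕ, w.support ⊆ Z ∧ u + w = v := by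
  constructor
  · rintro ⟨huv, hZ⟩
    refine ⟨v - u, fun i hi => ?_, add_tsub_cancel_of_le huv⟩
    by_contra hiZ
    simp [hZ i hiZ] at hi
  · rintro ⟨w, hw, rfl⟩
    refine ⟨le_self_add, fun i hi => ?_⟩
    rw [Finsupp.add_apply, Finsupp.notMem_support_iff.1 fun h => hi (hw h), add_zero]

theorem self_mem_cone : u ∈ cone u Z :=
  ⟨le_rfl, fun _ _ => rfl⟩

theorem add_mem_cone {w : σ →₀ ℕ} (hv : v ∈ cone u Z) (hw : w.support ⊆ Z) : v + w ∈ cone u Z := by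
  classical
  obtain ⟨w', hw', rfl⟩ := mem_cone_iff_exists_add.1 hv
  exact mem_cone_iff_exists_add.2
    ⟨w' + w, Finsupp.support_add.trans (Finset.union_subset hw' hw), (add_assoc _ _ _).symm⟩

theorem cone_indicator {A B : Finset σ} (hAB : A ⊆ B) :
    cone (Finsupp.indicator A fun _ _ => 1) B = Finsupp.support ⁻¹' Set.Icc A B := by
  classical
  ext v
  simp only [cone, Set.mem_ofPred_eq, Finsupp.le_def, Set.mem_preimage, Set.mem_Icc,
    Finset.subset_iff, Finsupp.mem_support_iff, ← forall_and]
  refine forall_congr' fun i => ?_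
  by_cases hA : i ∈ A
  · simp [Finsupp.indicator_apply, hA, hAB hA, Nat.one_le_iff_ne_zero]
  · simp [Finsupp.indicator_apply, hA, not_imp_comm]

theorem IsIndexedPartition.exists_eq_of_minimal {ι : Type*} {u : ι → σ →₀ ℕ} {Z : ι → Finset σ}
    (hP : IsIndexedPartition (fun i => cone (u i) (Z i)) E) (hv : Minimal (· ∈ E) v) :
    ∃ i, u i = v := by
  obtain ⟨i, hi⟩ := (hP.existsUnique v hv.prop).exists
  exact ⟨i, hv.eq_of_le (hP.subset i self_mem_cone) hi.1⟩

/-- The set `E` of exponents is partitioned into finitely many cones of dimension at least `k`. -/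
def HasConePartition (E : Set (σ →₀ ℕ)) (k : ℕ) : Prop :=
  ∃ (ι : Type) (_ : Finite ι) (u : ι → σ →₀ ℕ) (Z : ι → Finset σ),
    IsIndexedPartition (fun i => cone (u i) (Z i)) E ∧ ∀ i, k ≤ #(Z i)

theorem HasIntervalPartition.hasConePartition {𝓔 : Set (Finset σ)}
    (h : HasIntervalPartition 𝓔 k) : HasConePartition (Finsupp.support ⁻¹' 𝓔) k := by
  obtain ⟨ι, hι, A, B, hP, hAB⟩ := h
  refine ⟨ι, hι, fun i => Finsupp.indicator (A i) fun _ _ => 1, B, ?_, fun i => (hAB i).2⟩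
  simpa only [cone_indicator (hAB _).1] using hP.preimage Finsupp.support

theorem HasConePartition.exists_add_mem (h : HasConePartition E k) (hv : v ∈ E) :
    ∃ Z : Finset σ, k ≤ #Z ∧ ∀ w : σ →₀ ℕ, w.support ⊆ Z → v + w ∈ E := by
  obtain ⟨ι, -, u, Z, hP, hk⟩ := h
  obtain ⟨i, hi⟩ := (hP.existsUnique v hv).exists
  exact ⟨Z i, hk i, fun w hw => hP.subset i (add_mem_cone hi hw)⟩

end Cone

section MonomialBasis

variable {σ K M : Type*} [Field K] [AddCommGroup M] [Module K M] [Module (MvPolynomial σ K) M]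

theorem toSubmodule_supported (Z : Finset σ) :
    Subalgebra.toSubmodule (supported K (Z : Set σ)) =
      Submodule.span K ((monomial · 1) '' {w | w.support ⊆ Z}) := by
  rw [← restrictSupport_eq_span]
  ext p
  simp only [Subalgebra.mem_toSubmodule, mem_supported, mem_restrictSupport_iff, Set.subset_def,
    Finset.mem_coe, mem_vars_iff_mem_support, Set.mem_ofPred_eq, Finset.subset_iff]
  exact ⟨fun h w hw i hi => h i ⟨w, hw, hi⟩, fun h i ⟨w, hw, hi⟩ => h w hw hi⟩

theorem monomial_mem_supported {w : σ →₀ ℕ} {Z : Finset σ} (hw : w.support ⊆ Z) :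
    monomial w (1 : K) ∈ supported K (Z : Set σ) := by
  rw [mem_supported, vars_monomial one_ne_zero]
  exact_mod_cast hw

theorem stanleySpace_smul [IsScalarTower K (MvPolynomial σ K) M] {c : K} (hc : c ≠ 0) (m : M)
    (Z : Finset σ) : stanleySpace (c • m) Z = stanleySpace (K := K) m Z := by
  have h : (LinearMap.toSpanSingleton (MvPolynomial σ K) M (c • m)).restrictScalars K =
      c • (LinearMap.toSpanSingleton (MvPolynomial σ K) M m).restrictScalars K := by
    ext p
    simp [smul_algebra_smul_comm]
  rw [stanleySpace, h, Submodule.map_smul _ _ _ hc, stanleySpace]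

theorem bddAbove_range_depth [Finite σ] [IsScalarTower K (MvPolynomial σ K) M]
    (ℳ : (σ → ℤ) → Submodule K M) :
    BddAbove (Set.range fun D : StanleyDecomposition ℳ => D.depth) := by
  have := Fintype.ofFinite σ
  refine ⟨Fintype.card σ, ?_⟩
  rintro _ ⟨D, rfl⟩
  rcases isEmpty_or_nonempty (Fin D.r) with hr | ⟨⟨i⟩⟩
  · simp [StanleyDecomposition.depth]
  · exact ciInf_le_of_le (OrderBot.bddBelow _) i (Finset.card_le_univ _)

/-- The basis `b`, indexed by a set `E` of exponents, consists of homogeneous elements on which the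
monomials act by translation of the exponents, elements outside `E` standing for zero; moreover
every homogeneous element is a multiple of one of these. -/
structure IsMonomialBasis {E : Set (σ →₀ ℕ)} (ℳ : (σ → ℤ) → Submodule K M)
    (b : Module.Basis E K M) : Prop where
  monomial_smul : ∀ (v : E) (w : σ →₀ ℕ) (h : ↑v + w ∈ E), monomial w (1 : K) • b v = b ⟨v + w, h⟩
  monomial_smul_eq_zero : ∀ (v : E) (w : σ →₀ ℕ), ↑v + w ∉ E → monomial w (1 : K) • b v = 0
  mem : ∀ v : E, b v ∈ ℳ fun i => (v : σ →₀ ℕ) i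
  exists_eq_smul : ∀ a, ∀ x ∈ ℳ a, x ≠ 0 → ∃ (v : E) (c : K), x = c • b v

namespace IsMonomialBasis

variable [IsScalarTower K (MvPolynomial σ K) M] {ℳ : (σ → ℤ) → Submodule K M}
  {E : Set (σ →₀ ℕ)} {b : Module.Basis E K M} {Z : Finset σ} {k : ℕ}

theorem stanleySpace_eq_span (h : IsMonomialBasis ℳ b) {u : E} (hZ : cone u Z ⊆ E) :
    stanleySpace (b u) Z = Submodule.span K (b '' (((↑) : E → σ →₀ ℕ) ⁻¹' cone u Z)) := by
  rw [stanleySpace, toSubmodule_supported, Submodule.map_span, ← Set.image_comp]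
  congr 1
  ext x
  simp only [Set.mem_image, Set.mem_preimage, Subtype.exists, mem_cone_iff_exists_add]
  constructor
  · rintro ⟨w, hw, rfl⟩
    have huw : u + w ∈ E := hZ (mem_cone_iff_exists_add.2 ⟨w, hw, rfl⟩)
    exact ⟨u + w, huw, ⟨w, hw, rfl⟩, (h.monomial_smul u w huw).symm⟩
  · rintro ⟨_, huw, ⟨w, hw, rfl⟩, rfl⟩
    exact ⟨w, hw, h.monomial_smul u w huw⟩

theorem eq_zero_of_smul_eq_zero (h : IsMonomialBasis ℳ b) {u : E} (hZ : cone u Z ⊆ E)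
    {p : MvPolynomial σ K} (hp : p ∈ supported K (Z : Set σ)) (hpu : p • b u = 0) : p = 0 := by
  have huw (w : {w : σ →₀ ℕ | w.support ⊆ Z}) : (u : σ →₀ ℕ) + w ∈ E :=
    hZ (mem_cone_iff_exists_add.2 ⟨w, w.2, rfl⟩)
  have hcomp : (LinearMap.toSpanSingleton (MvPolynomial σ K) M (b u)).restrictScalars K ∘
      (fun w : {w : σ →₀ ℕ | w.support ⊆ Z} => monomial (w : σ →₀ ℕ) (1 : K)) =
        b ∘ fun w => ⟨_, huw w⟩ :=
    funext fun w => h.monomial_smul u w (huw w)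
  have hli := b.linearIndependent.comp (fun w => ⟨_, huw w⟩) fun w w' hww' =>
    Subtype.ext (add_left_cancel (Subtype.ext_iff.1 hww'))
  rw [← hcomp] at hli
  rw [← Subalgebra.mem_toSubmodule, toSubmodule_supported, Set.image_eq_range] at hp
  exact Submodule.disjoint_def.1 (Submodule.range_ker_disjoint hli) p hp hpu

theorem exists_eq_smul_of_free (h : IsMonomialBasis ℳ b) {m : M} (hm : ∃ a, m ∈ ℳ a)
    (hfree : ∀ p ∈ supported K (Z : Set σ), p • m = 0 → p = 0) :
    ∃ (u : E) (c : K), cone u Z ⊆ E ∧ c ≠ 0 ∧ m = c • b u := by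
  have hm0 : m ≠ 0 := fun h0 => one_ne_zero (hfree 1 (one_mem _) (by rw [h0, smul_zero]))
  obtain ⟨a, ha⟩ := hm
  obtain ⟨u, c, rfl⟩ := h.exists_eq_smul a m ha hm0
  refine ⟨u, c, fun v hv => ?_, fun hc => hm0 (by rw [hc, zero_smul]), rfl⟩
  obtain ⟨w, hw, rfl⟩ := mem_cone_iff_exists_add.1 hv
  by_contra huw
  have := hfree _ (monomial_mem_supported hw) (by
    rw [smul_algebra_smul_comm, h.monomial_smul_eq_zero u w huw, smul_zero])
  simp at this

theorem isInternal_stanleySpace_iff (h : IsMonomialBasis ℳ b) {ι : Type*} [DecidableEq ι]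
    {u : ι → E} {Z : ι → Finset σ} (hZ : ∀ i, cone (u i) (Z i) ⊆ E) :
    (DirectSum.IsInternal fun i => stanleySpace (K := K) (b (u i)) (Z i)) ↔
      IsIndexedPartition (fun i => cone (u i : σ →₀ ℕ) (Z i)) E := by
  simp_rw [h.stanleySpace_eq_span (hZ _), isInternal_span_image_iff,
    isIndexedPartition_preimage_val_iff hZ]

theorem exists_isIndexedPartition_cone (h : IsMonomialBasis ℳ b) (D : StanleyDecomposition ℳ) :
    ∃ u : Fin D.r → σ →₀ ℕ, IsIndexedPartition (fun i => cone (u i) (D.Z i)) E := by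
  choose u c hZ hc hm using fun i => h.exists_eq_smul_of_free (D.homogeneous i) (D.free i)
  refine ⟨fun i => u i, (h.isInternal_stanleySpace_iff hZ).1 ?_⟩
  simpa only [hm, stanleySpace_smul (hc _)] using D.isInternal

theorem exists_stanleyDecomposition (h : IsMonomialBasis ℳ b) {r : ℕ} {u : Fin r → σ →₀ ℕ}
    {Z : Fin r → Finset σ} (hP : IsIndexedPartition (fun i => cone (u i) (Z i)) E) :
    ∃ D : StanleyDecomposition ℳ, D.depth = ⨅ i, #(Z i) := by
  let v (i : Fin r) : E := ⟨u i, hP.subset i self_mem_cone⟩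
  exact ⟨⟨r, fun i => b (v i), Z, fun i => ⟨_, h.mem (v i)⟩,
    fun i p hp => h.eq_zero_of_smul_eq_zero (hP.subset i) hp,
    (h.isInternal_stanleySpace_iff hP.subset).2 hP⟩, rfl⟩

variable [Fintype σ]

theorem sdepth_le (h : IsMonomialBasis ℳ b) (hk : ∀ d, HasConePartition E d → d ≤ k) :
    sdepth ℳ ≤ k := by
  refine csSup_le' ?_
  rintro _ ⟨D, rfl⟩
  obtain ⟨u, hP⟩ := h.exists_isIndexedPartition_cone D
  exact hk _ ⟨Fin D.r, inferInstance, u, D.Z, hP, fun i => ciInf_le (OrderBot.bddBelow _) i⟩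

theorem le_sdepth (h : IsMonomialBasis ℳ b) (hk : HasConePartition E k) (hE : E.Nonempty) :
    k ≤ sdepth ℳ := by
  obtain ⟨ι, _, u, Z, hP, hkZ⟩ := hk
  let e := (Finite.equivFin ι).symm
  obtain ⟨D, hD⟩ := h.exists_stanleyDecomposition (u := u ∘ e) (Z := Z ∘ e) (hP.comp_equiv e)
  have : Nonempty (Fin (Nat.card ι)) := hE.elim fun v hv => ⟨e.symm (hP.existsUnique v hv).choose⟩
  have hkD : k ≤ D.depth := hD ▸ le_ciInf fun i => hkZ (e i)
  exact hkD.trans (le_csSup (bddAbove_range_depth ℳ) ⟨D, rfl⟩)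

end IsMonomialBasis

end MonomialBasis

section MonomialIdeal

variable {σ K : Type*} [Field K] {I : Ideal (MvPolynomial σ K)} {E : Set (σ →₀ ℕ)}

theorem monomial_mem_polyGrading (v : σ →₀ ℕ) (c : K) :
    monomial v c ∈ polyGrading σ K fun i => v i :=
  (monomial_mem_restrictSupport K).2 (.inl fun _ => rfl)

theorem exists_eq_monomial_of_mem_polyGrading {a : σ → ℤ} {p : MvPolynomial σ K}
    (hp : p ∈ polyGrading σ K a) : ∃ v c, p = monomial v c := by
  rcases p.support.eq_empty_or_nonempty with h0 | ⟨v, hv⟩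
  · exact ⟨0, 0, by rw [support_eq_empty.1 h0, monomial_zero]⟩
  · refine ⟨v, _, eq_monomial_of_support_subset_singleton fun w hw => Finsupp.ext fun i => ?_⟩
    exact_mod_cast (hp hw i).trans (hp hv i).symm

theorem coe_basisRestrictSupport (v : E) :
    (basisRestrictSupport K E v : MvPolynomial σ K) = monomial (v : σ →₀ ℕ) 1 :=
  congrArg AddMonoidAlgebra.ofCoeff (Finsupp.supportedEquivFinsupp_symm_single E v 1)

theorem isCompl_restrictSupport_compl (E : Set (σ →₀ ℕ)) :
    IsCompl (restrictSupport K E) (restrictSupport K Eᶜ) := by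
  simp only [restrictSupport_eq_span]
  exact (basisMonomials σ K).linearIndependent.isCompl_span_image
    (basisMonomials σ K).span_eq isCompl_compl

theorem monomial_mem_iff_of_restrictScalars_eq (hI : I.restrictScalars K = restrictSupport K E)
    {v : σ →₀ ℕ} {c : K} : monomial v c ∈ I ↔ v ∈ E ∨ c = 0 := by
  rw [← Submodule.restrictScalars_mem K, hI, monomial_mem_restrictSupport]

/-- The basis of a monomial ideal consisting of the monomials in it. -/
noncomputable def idealBasis (hI : I.restrictScalars K = restrictSupport K E) :
    Module.Basis E K I :=
  (basisRestrictSupport K E).map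
    (LinearEquiv.ofEq _ _ hI.symm ≪≫ₗ (Submodule.restrictScalarsEquiv K _ _ I).restrictScalars K)

theorem coe_idealBasis (hI : I.restrictScalars K = restrictSupport K E) (v : E) :
    (idealBasis hI v : MvPolynomial σ K) = monomial (v : σ →₀ ℕ) 1 := by
  rw [idealBasis, Module.Basis.map_apply]
  exact coe_basisRestrictSupport v

theorem isMonomialBasis_idealBasis (hI : I.restrictScalars K = restrictSupport K E) :
    IsMonomialBasis (idealGrading I) (idealBasis hI) where
  monomial_smul v w _ := by
    ext1
    rw [Submodule.coe_smul, coe_idealBasis, coe_idealBasis, smul_eq_mul, monomial_mul, one_mul,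
      add_comm w]
  monomial_smul_eq_zero v w h := by
    have hvw := I.mul_mem_left (monomial w 1) (idealBasis hI v).2
    rw [coe_idealBasis, monomial_mul, one_mul, add_comm w,
      monomial_mem_iff_of_restrictScalars_eq hI] at hvw
    exact absurd (hvw.resolve_right one_ne_zero) h
  mem v := by
    have hv := monomial_mem_polyGrading (K := K) (v : σ →₀ ℕ) 1
    rwa [← coe_idealBasis hI v] at hv
  exists_eq_smul a x hx hx0 := by
    obtain ⟨p, hpI⟩ := x
    obtain ⟨v, c, rfl⟩ := exists_eq_monomial_of_mem_polyGrading hx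
    have hc : c ≠ 0 := by
      rintro rfl
      simp at hx0
    refine ⟨⟨v, ((monomial_mem_iff_of_restrictScalars_eq hI).1 hpI).resolve_right hc⟩, c, ?_⟩
    ext1
    rw [Submodule.coe_smul_of_tower, coe_idealBasis, smul_monomial, smul_eq_mul, mul_one]

/-- The basis of the quotient by a monomial ideal consisting of the classes of the monomials
outside the ideal. -/
noncomputable def quotientBasis (hI : I.restrictScalars K = restrictSupport K E) :
    Module.Basis ↥Eᶜ K (MvPolynomial σ K ⧸ I) :=
  (basisRestrictSupport K Eᶜ).map
    ((Submodule.quotientEquivOfIsCompl _ _ (hI ▸ isCompl_restrictSupport_compl E)).symm ≪≫ₗ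
      (Submodule.Quotient.restrictScalarsEquiv K I).restrictScalars K)

theorem quotientBasis_apply (hI : I.restrictScalars K = restrictSupport K E) (v : ↥Eᶜ) :
    quotientBasis hI v = I.mkQ (monomial (v : σ →₀ ℕ) 1) :=
  congrArg I.mkQ (coe_basisRestrictSupport v)

theorem isMonomialBasis_quotientBasis (hI : I.restrictScalars K = restrictSupport K E) :
    IsMonomialBasis (quotientGrading I) (quotientBasis hI) where
  monomial_smul v w _ := by
    rw [quotientBasis_apply, quotientBasis_apply, ← map_smul, smul_eq_mul, monomial_mul, one_mul,
      add_comm w]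
  monomial_smul_eq_zero v w h := by
    rw [quotientBasis_apply, ← map_smul, smul_eq_mul, monomial_mul, one_mul, add_comm w,
      Submodule.mkQ_apply, Submodule.Quotient.mk_eq_zero,
      monomial_mem_iff_of_restrictScalars_eq hI]
    exact .inl (not_not.1 h)
  mem v := ⟨_, monomial_mem_polyGrading _ 1, (quotientBasis_apply hI v).symm⟩
  exists_eq_smul a x hx hx0 := by
    obtain ⟨p, hp, rfl⟩ := hx
    obtain ⟨v, c, rfl⟩ := exists_eq_monomial_of_mem_polyGrading hp
    have hv : v ∉ E := fun hv => hx0 ((Submodule.Quotient.mk_eq_zero I).2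
      ((monomial_mem_iff_of_restrictScalars_eq hI).2 (.inl hv)))
    refine ⟨⟨v, hv⟩, c, ?_⟩
    rw [quotientBasis_apply, ← LinearMap.map_smul_of_tower, smul_monomial, smul_eq_mul, mul_one]
    rfl

end MonomialIdeal

section SplitFamily

theorem exists_two_mul_card_filter_lt {α : Type*} {s : Finset α} {r : α → α → Prop}
    [DecidableRel r] (hs : s.Nonempty) (hr : ∀ i ∈ s, ∀ j ∈ s, r i j → ¬ r j i) :
    ∃ i ∈ s, 2 * #{j ∈ s | r i j} < #s := by
  classical
  refine Finset.exists_lt_of_sum_lt ?_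
  have hsum : ∑ i ∈ s, #{j ∈ s | r i j} = ∑ i ∈ s, #{j ∈ s | r j i} :=
    Finset.sum_card_bipartiteAbove_eq_sum_card_bipartiteBelow r
  calc ∑ i ∈ s, 2 * #{j ∈ s | r i j}
      = ∑ i ∈ s, (#{j ∈ s | r i j} + #{j ∈ s | r j i}) := by
        rw [← Finset.mul_sum, Finset.sum_add_distrib, ← hsum, two_mul]
    _ < ∑ _i ∈ s, #s := Finset.sum_lt_sum_of_nonempty hs fun i hi => by
        rw [← Finset.card_union_of_disjoint (Finset.disjoint_filter.2 (hr i hi))]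
        refine Finset.card_lt_card (Finset.ssubset_iff.2 ⟨i, ?_, ?_⟩)
        · have hii : ¬ r i i := fun h => hr i hi i hi h h
          simp [hii]
        · simp [Finset.insert_subset_iff, hi, Finset.union_subset_iff, Finset.filter_subset]

variable {σ : Type*} [DecidableEq σ] {A : Finset σ} {E : Set (σ →₀ ℕ)} {d : ℕ}

/-- The sets that meet both `A` and its complement: the supports of the monomials in the ideal
`(x_i : i ∈ A) ∩ (x_i : i ∉ A)`. -/
def splitFamily (A : Finset σ) : Set (Finset σ) :=
  {C | (C ∩ A).Nonempty ∧ (C \ A).Nonempty}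

theorem minimal_single_add_single {x y : σ} (hx : x ∈ A) (hy : y ∉ A) :
    Minimal (· ∈ Finsupp.support ⁻¹' splitFamily A) (Finsupp.single x 1 + Finsupp.single y 1) := by
  have hyx : y ≠ x := ne_of_mem_of_not_mem hx hy |>.symm
  refine ⟨⟨⟨x, ?_⟩, ⟨y, ?_⟩⟩, ?_⟩
  · simp [hx]
  · simp [hy]
  · rintro w ⟨⟨x', hx'⟩, ⟨y', hy'⟩⟩ hw
    simp only [Finset.mem_inter, Finset.mem_sdiff, Finsupp.mem_support_iff] at hx' hy'
    have eq_or_eq {i : σ} (hi : w i ≠ 0) : i = x ∨ i = y := by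
      by_contra! h
      have := hw i
      simp [h.1, h.2, hi] at this
    obtain rfl : x' = x := (eq_or_eq hx'.1).resolve_right (ne_of_mem_of_not_mem hx'.2 hy)
    obtain rfl : y' = y := (eq_or_eq hy'.1).resolve_left (ne_of_mem_of_not_mem hx hy'.2).symm
    intro i
    rcases eq_or_ne i x' with rfl | hix
    · simpa [hyx] using Nat.one_le_iff_ne_zero.2 hx'.1
    rcases eq_or_ne i y' with rfl | hiy
    · simpa [hyx.symm] using Nat.one_le_iff_ne_zero.2 hy'.1
    · simp [hix, hiy]

variable [Fintype σ]

theorem HasConePartition.le_card_compl_of_compl_splitFamily (hA : Aᶜ.Nonempty)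
    (h : HasConePartition (Finsupp.support ⁻¹' splitFamily A)ᶜ d) : d ≤ #Aᶜ := by
  obtain ⟨y, hy⟩ := hA
  rw [Finset.mem_compl] at hy
  obtain ⟨Z, hd, hZ⟩ := h.exists_add_mem (v := Finsupp.single y 1) fun hy' => by
    obtain ⟨x, hx⟩ := hy'.1
    rw [Finset.mem_inter, Finsupp.support_single y one_ne_zero, Finset.mem_singleton] at hx
    exact hy (hx.1 ▸ hx.2)
  refine hd.trans (Finset.card_le_card fun x hx => Finset.mem_compl.2 fun hxA => ?_)
  refine hZ (Finsupp.single x 1) (Finsupp.support_single_subset.trans (by simpa using hx)) ?_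
  rw [add_comm]
  exact (minimal_single_add_single hxA hy).prop

theorem HasConePartition.le_of_splitFamily (hA : A.Nonempty) (hA' : Aᶜ.Nonempty)
    (h : HasConePartition (Finsupp.support ⁻¹' splitFamily A) d) : d ≤ #Aᶜ + (#A + 1) / 2 := by
  classical
  obtain ⟨ι, -, u, Z, hP, hd⟩ := h
  obtain ⟨y, hy⟩ := hA'
  rw [Finset.mem_compl] at hy
  let v (i : σ) : σ →₀ ℕ := Finsupp.single i 1 + Finsupp.single y 1
  have mem_cone {i j : σ} {k : ι} (hk : u k = v i) (hj : j ∈ Z k) :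
      v i + Finsupp.single j 1 ∈ cone (u k) (Z k) :=
    add_mem_cone (hk ▸ self_mem_cone)
      (Finsupp.support_single_subset.trans (Finset.singleton_subset_iff.2 hj))
  have v_injective : Function.Injective v := fun i j hij =>
    Finsupp.single_left_injective one_ne_zero (add_right_cancel hij)
  let r (i j : σ) : Prop := j ≠ i ∧ ∃ k, u k = v i ∧ j ∈ Z k
  have r_asymm : ∀ i ∈ A, ∀ j ∈ A, r i j → ¬ r j i := by
    rintro i - j - ⟨hij, k, hk, hjk⟩ ⟨-, l, hl, hil⟩
    have hk' := mem_cone hk hjk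
    have hl' := mem_cone hl hil
    rw [show v j + Finsupp.single i 1 = v i + Finsupp.single j 1 by simp only [v]; abel] at hl'
    obtain rfl := (hP.existsUnique _ (hP.subset k hk')).unique hk' hl'
    exact hij (v_injective (hl.symm.trans hk))
  obtain ⟨i, hi, hlt⟩ := exists_two_mul_card_filter_lt hA r_asymm
  obtain ⟨k, hk⟩ := hP.exists_eq_of_minimal (minimal_single_add_single hi hy)
  have hZ : Z k ⊆ Aᶜ ∪ insert i {j ∈ A | r i j} := by
    intro j hj
    simp only [Finset.mem_union, Finset.mem_compl, Finset.mem_insert, Finset.mem_filter]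
    by_cases hjA : j ∈ A
    · exact .inr (or_iff_not_imp_left.2 fun hji => ⟨hjA, hji, k, hk, hj⟩)
    · exact .inl hjA
  have hcard := (Finset.card_le_card hZ).trans (Finset.card_union_le _ _)
  have hinsert := Finset.card_insert_le i {j ∈ A | r i j}
  have := hd k
  omega

theorem hasIntervalPartition_splitFamily (A : Finset σ) :
    HasIntervalPartition (splitFamily A) ((#A + 1) / 2 + (#Aᶜ + 1) / 2) := by
  convert (hasIntervalPartition_nonempty_subsets A).inter_sdiff (S := A)
    (hasIntervalPartition_nonempty_subsets Aᶜ) (fun C hC => hC.2)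
    (fun C hC => Finset.subset_compl_iff_disjoint_right.1 hC.2) using 1
  ext C
  simp [splitFamily, Finset.subset_compl_iff_disjoint_right, Finset.sdiff_disjoint]

theorem hasIntervalPartition_compl_splitFamily (A : Finset σ) :
    HasIntervalPartition (splitFamily A)ᶜ (min #Aᶜ ((#A + 1) / 2)) := by
  convert ((HasIntervalPartition.of_Icc (Finset.empty_subset Aᶜ)).mono (min_le_left _ _)).union
    ((hasIntervalPartition_nonempty_subsets A).mono (min_le_right _ _)) ?_ using 1
  · ext C
    simp only [splitFamily, Set.mem_compl_iff, Set.mem_union, Set.mem_ofPred_eq, Set.mem_Icc,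
      Finset.Nonempty, Finset.subset_iff, Finset.mem_inter, Finset.mem_sdiff, Finset.mem_compl]
    grind
  · refine Set.disjoint_left.2 fun C hC hC' => ?_
    obtain ⟨x, hx⟩ := hC'.1
    exact Finset.mem_compl.1 (hC.2 hx) (hC'.2 hx)

end SplitFamily

section SplitIdeal

variable {σ : Type*}

/-- The ideal `(x_i : i ∈ A) ∩ (x_i : i ∉ A)`. -/
noncomputable def splitIdeal (K : Type*) [Field K] (A : Finset σ) : Ideal (MvPolynomial σ K) :=
  Ideal.span (X '' (A : Set σ)) ⊓ Ideal.span (X '' (A : Set σ)ᶜ)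

theorem restrictScalars_splitIdeal [DecidableEq σ] (K : Type*) [Field K] (A : Finset σ) :
    (splitIdeal K A).restrictScalars K =
      restrictSupport K (Finsupp.support ⁻¹' splitFamily A) := by
  ext p
  simp only [splitIdeal, Submodule.restrictScalars_mem, Submodule.mem_inf,
    mem_ideal_span_X_image, mem_restrictSupport_iff, ← forall_and]
  refine forall₂_congr fun v _ => ?_
  simp only [splitFamily, Set.mem_preimage, Set.mem_ofPred_eq, Finset.Nonempty, Finset.mem_inter,
    Finset.mem_sdiff, Finsupp.mem_support_iff, Set.mem_compl_iff, Finset.mem_coe]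
  simp only [and_comm]

theorem compl_map_castAddEmb_univ (n m : ℕ) :
    (Finset.univ.map (Fin.castAddEmb m : Fin n ↪ Fin (n + m)))ᶜ =
      Finset.univ.map (Fin.natAddEmb n) := by
  ext i
  induction i using Fin.addCases <;> simp [Fin.ext_iff] <;> omega

theorem bipartiteIdeal_eq_splitIdeal (K : Type*) [Field K] (n m : ℕ) :
    bipartiteIdeal K n m = splitIdeal K (Finset.univ.map (Fin.castAddEmb m)) := by
  rw [bipartiteIdeal, splitIdeal, ← Finset.coe_compl, compl_map_castAddEmb_univ]
  simp only [Finset.coe_map, Finset.coe_univ, Set.image_univ, ← Set.range_comp]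
  rfl

end SplitIdeal

theorem natCeil_half (n : ℕ) : ⌈(n : ℚ) / 2⌉₊ = (n + 1) / 2 := by
  refine le_antisymm (Nat.ceil_le.2 ?_) ?_
  · have h : n ≤ 2 * ((n + 1) / 2) := by omega
    have h' : (n : ℚ) ≤ 2 * ((n + 1) / 2 : ℕ) := by exact_mod_cast h
    linarith
  · have h : (n : ℚ) ≤ 2 * ⌈(n : ℚ) / 2⌉₊ := by linarith [Nat.le_ceil ((n : ℚ) / 2)]
    have h' : n ≤ 2 * ⌈(n : ℚ) / 2⌉₊ := by exact_mod_cast h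
    omega

end StanleyDepth

open StanleyDepth in
open scoped Finset in
theorem proposition2p2_general (K : Type*) [Field K] {σ : Type*} [Fintype σ] [DecidableEq σ]
    {A : Finset σ} (hA : A.Nonempty) (hA' : Aᶜ.Nonempty) :
    (sdepth (quotientGrading (splitIdeal K A)) ≤ #Aᶜ ∧
      min #Aᶜ ⌈(#A : ℚ) / 2⌉₊ ≤ sdepth (quotientGrading (splitIdeal K A))) ∧
    (sdepth (idealGrading (splitIdeal K A)) ≤ #Aᶜ + ⌈(#A : ℚ) / 2⌉₊ ∧
      ⌈(#A : ℚ) / 2⌉₊ + ⌈(#Aᶜ : ℚ) / 2⌉₊ ≤ sdepth (idealGrading (splitIdeal K A))) ∧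
    (2 * #Aᶜ - 1 ≤ #A → sdepth (quotientGrading (splitIdeal K A)) = #Aᶜ) := by
  simp only [natCeil_half]
  have hsplit := restrictScalars_splitIdeal K A
  have hquotient := isMonomialBasis_quotientBasis hsplit
  have hideal := isMonomialBasis_idealBasis hsplit
  have quotient_le := hquotient.sdepth_le fun d =>
    HasConePartition.le_card_compl_of_compl_splitFamily hA'
  have le_quotient := hquotient.le_sdepth
    (hasIntervalPartition_compl_splitFamily A).hasConePartition
    ⟨0, fun h => by simpa using h.1⟩
  refine ⟨⟨quotient_le, le_quotient⟩, ⟨?_, ?_⟩, fun hmn => quotient_le.antisymm ?_⟩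
  · exact hideal.sdepth_le fun d => HasConePartition.le_of_splitFamily hA hA'
  · obtain ⟨x, hx⟩ := hA
    obtain ⟨y, hy⟩ := hA'
    exact hideal.le_sdepth (hasIntervalPartition_splitFamily A).hasConePartition
      ⟨_, (minimal_single_add_single hx (Finset.mem_compl.1 hy)).prop⟩
  · exact le_quotient.trans' (by omega)

theorem proposition2p2 (K : Type*) [Field K] (n m : ℕ) (hm : 1 ≤ m) (hmn : m ≤ n) :
    (StanleyDepth.sdepth (StanleyDepth.quotientGrading (StanleyDepth.bipartiteIdeal K n m)) ≤ m ∧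
      min m ⌈(n : ℚ) / 2⌉₊ ≤
        StanleyDepth.sdepth (StanleyDepth.quotientGrading (StanleyDepth.bipartiteIdeal K n m))) ∧
    (StanleyDepth.sdepth (StanleyDepth.idealGrading (StanleyDepth.bipartiteIdeal K n m)) ≤
        m + ⌈(n : ℚ) / 2⌉₊ ∧
      ⌈(n : ℚ) / 2⌉₊ + ⌈(m : ℚ) / 2⌉₊ ≤
        StanleyDepth.sdepth (StanleyDepth.idealGrading (StanleyDepth.bipartiteIdeal K n m))) ∧
    (2 * m - 1 ≤ n →
      StanleyDepth.sdepth (StanleyDepth.quotientGrading (StanleyDepth.bipartiteIdeal K n m)) = m) :=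
  by
  rw [StanleyDepth.bipartiteIdeal_eq_splitIdeal]
  have hn : (Finset.univ.map (Fin.castAddEmb m : Fin n ↪ _)).card = n := by simp
  have hm' : (Finset.univ.map (Fin.castAddEmb m : Fin n ↪ _))ᶜ.card = m := by
    simp [StanleyDepth.compl_map_castAddEmb_univ]
  simpa only [hn, hm'] using proposition2p2_general K
    (A := Finset.univ.map (Fin.castAddEmb m : Fin n ↪ Fin (n + m)))
    (Finset.card_pos.1 (by omega)) (Finset.card_pos.1 (by omega))
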